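/- Let $\Sigma$ be an alphabet with a converse operation $a\mapsto\bar a$ satisfying $\bar{\bar a}=a$, such that $\Sigma$ can be partitioned into $\Sigma^+$ and $\Sigma^-$ with $a\in\Sigma^+$ iff $\bar a\in\Sigma^-$; for a string put $\overline{a_1\cdots a_n}=\bar a_n\cdots\bar a_1$. A semi-Thue system $S$ is a set of production rules $u\to v$ with $u,v\in\Sigma^*$; it is closed if $u\to v\in S$ implies $\bar u\to\bar v\in S$, and context-free if every rule has the form $a\to v$ with $a\in\Sigma$. Write $\Rightarrow_S$ for the reflexive-transitive rewriting relation on strings generated by $S$, and $L_a(S)=\{u\in\Sigma^*\mid a\Rightarrow_S u\}$. Formulae are in negation normal form, $A::=p\mid\neg p\mid A\lor A\mid A\land A\mid[a]A\mid\langle a\rangle A$ with $a\in\Sigma$ and $p$ an atom; $\overline{A}$ denotes the negation normal form of $\neg A$. A nested sequent is a finite multiset $A_1,\dots,A_m,\{\Delta_1\}^{a_1},\dots,\{\Delta_n\}^{a_n}$ of formulae $A_i$ and structures $\{\Delta_k\}^{a_k}$, where the $\Delta_k$ are nested sequents and $a_k\in\Sigma$; it is viewed as a finite tree whose nodes are multisets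 of formulae and whose edges are labelled by letters. For $u=a_1\cdots a_n$ let $\{\Delta\}^u$ be $\{\cdots\{\Delta\}^{a_n}\cdots\}^{a_1}$ (and $\Delta$ if $n=0$). $\Gamma[\ ]$ is a context with a hole at an arbitrary node, and $\Gamma[\ ]_i[\ ]_j$ is a context with two holes at the (possibly equal) nodes $i,j$. The shallow calculus $\mathrm{SKm}(S)$ has the following rules (premises $\Rightarrow$ conclusion): - (id) $\Gamma,p,\neg p$ without premises; - (cut) $\Gamma,A$ and $\Delta,\overline{A}$ $\Rightarrow$ $\Gamma,\Delta$; - (ctr) $\Gamma,\Delta,\Delta\Rightarrow\Gamma,\Delta$; - (wk) $\Gamma\Rightarrow\Gamma,\Delta$; - (r) $\Gamma,\{\Delta\}^a\Rightarrow\{\Gamma\}^{\bar a},\Delta$; - ($\land$) $\Gamma,A$ and $\Gamma,B$ $\Rightarrow$ $\Gamma,A\land B$; - ($\lor$) $\Gamma,A,B\Rightarrow\Gamma,A\lor B$; - ($[a]$) $\Gamma,\{A\}^a\Rightarrow\Gamma,[a]A$; - ($\langle a\rangle$) $\Gamma,\{\Delta,A\}^a\Rightarrow\Gamma,\{\Delta\}^a,\langle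 a\rangle A$; - ($\rho(S)$) $\{\Delta\}^u,\Gamma\Rightarrow\{\Delta\}^v,\Gamma$ for each $u\to v\in S$. The deep inference calculus $\mathrm{DKm}(S)$ has the following rules, for all contexts $\Gamma[\ ]$: - $\Gamma[p,\neg p]$ without premises; - $\Gamma[A\land B,A]$ and $\Gamma[A\land B,B]$ $\Rightarrow$ $\Gamma[A\land B]$; - $\Gamma[A\lor B,A,B]\Rightarrow\Gamma[A\lor B]$; - $\Gamma[[a]A,\{A\}^a]\Rightarrow\Gamma[[a]A]$; - $\Gamma[\{\Delta,A\}^a,\langle a\rangle A]\Rightarrow\Gamma[\{\Delta\}^a,\langle a\rangle A]$; - $\Gamma[\{\Delta,\langle\bar a\rangle A\}^a,A]\Rightarrow\Gamma[\{\Delta,\langle\bar a\rangle A\}^a]$; - ($p_S$) $\Gamma[\langle a\rangle A]_i[A]_j\Rightarrow\Gamma[\langle a\rangle A]_i[\emptyset]_j$, provided $\mathcal R(\Gamma[\ ]_i[\ ]_j,i,j)\cap L_a(S)\neq\emptyset$. Here $\mathcal R(\Gamma[\ ]_i[\ ]_j,i,j)$ is (the language of) the finite automaton whose states are the nodes of $\Gamma[\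 ]_i[\ ]_j$, with initial state $i$ and final state $j$, in which each tree edge from $x$ to its child $y$ labelled $a$ gives the two transitions $x\xrightarrow{a}y$ and $y\xrightarrow{\bar a}x$. **Theorem.** For every context-free closed semi-Thue system $S$ over $\Sigma$, the calculi $\mathrm{SKm}(S)$ and $\mathrm{DKm}(S)$ are equivalent: for every formula $A$, the nested sequent consisting of $A$ alone is derivable in $\mathrm{SKm}(S)$ if and only if it is derivable in $\mathrm{DKm}(S)$. -/

import Mathlib

namespace GrammarLogic

universe u v

/-- An alphabet with a converse operation: an involution that exchanges the two blocks of some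
partition of the alphabet. -/
class ConverseAlphabet (α : Type u) where
  conv : α → α
  conv_conv : ∀ a, conv (conv a) = a
  exists_partition : ∃ P N : Set α, IsCompl P N ∧ ∀ a, a ∈ P ↔ conv a ∈ N

/-- The converse of a string: `a₁ ⋯ aₙ` is sent to `āₙ ⋯ ā₁`. -/
def convStr {α : Type u} [ConverseAlphabet α] (w : List α) : List α :=
  (w.map ConverseAlphabet.conv).reverse

/-! ### Semi-Thue systems -/

/-- A semi-Thue system is a set of production rules; `(x, y) ∈ S` stands for `x → y`. -/
abbrev SemiThue (α : Type u) := Set (List α × List α)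

namespace SemiThue

variable {α : Type u}

def Closed [ConverseAlphabet α] (S : SemiThue α) : Prop :=
  ∀ x y, (x, y) ∈ S → (convStr x, convStr y) ∈ S

/-- Every production rule has the form `a → y` for a single letter `a`. -/
def ContextFree (S : SemiThue α) : Prop :=
  ∀ x y, (x, y) ∈ S → ∃ a : α, x = [a]

/-- One application of a production rule to a substring. -/
def Step (S : SemiThue α) (w w' : List α) : Prop :=
  ∃ l r x y, (x, y) ∈ S ∧ w = l ++ x ++ r ∧ w' = l ++ y ++ r

/-- `w` can be rewritten into `w'` by zero or more applications of production rules. -/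
def Derives (S : SemiThue α) : List α → List α → Prop :=
  Relation.ReflTransGen S.Step

/-- The language `L_a(S)` generated by `S` from the start symbol `a`. -/
def lang (S : SemiThue α) (a : α) : Language α :=
  {w | S.Derives [a] w}

end SemiThue

/-! ### Formulae -/

/-- Multi-modal formulae in negation normal form over the alphabet `α` and the atoms `At`. -/
inductive Form (α : Type u) (At : Type v) : Type (max u v)
  | atom (p : At)
  | natom (p : At)
  | or (A B : Form α At)
  | and (A B : Form α At)
  | box (a : α) (A : Form α At)
  | dia (a : α) (A : Form α At)

/-- The negation normal form of the negation of a formula. -/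
def Form.lneg {α : Type u} {At : Type v} : Form α At → Form α At
  | atom p => natom p
  | natom p => atom p
  | or A B => and A.lneg B.lneg
  | and A B => or A.lneg B.lneg
  | box a A => dia a A.lneg
  | dia a A => box a A.lneg

/-! ### Nested sequents -/

/-- Representatives of nested sequents: finite lists whose entries are formulae `A` or
structures `{Δ}^a`. Here `form A Γ` is `A, Γ` and `br a Δ Γ` is `{Δ}^a, Γ`. A nested sequent is
a (hereditary) multiset, that is, a representative up to `NestedSeq.Perm`. -/
inductive NestedSeq (α : Type u) (At : Type v) : Type (max u v)
  | nil
  | form (A : Form α At) (Γ : NestedSeq α At)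
  | br (a : α) (Δ Γ : NestedSeq α At)

namespace NestedSeq

variable {α : Type u} {At : Type v}

/-- The sequent `Γ, Δ`. -/
def append : NestedSeq α At → NestedSeq α At → NestedSeq α At
  | nil, Δ => Δ
  | form A Γ, Δ => form A (append Γ Δ)
  | br a Θ Γ, Δ => br a Θ (append Γ Δ)

instance : Append (NestedSeq α At) := ⟨append⟩

/-- The sequent that consists of one formula. -/
def single (A : Form α At) : NestedSeq α At := form A nil

/-- The sequent `{Δ}^a`. -/
def bracket (a : α) (Δ : NestedSeq α At) : NestedSeq α At := br a Δ nil

/-- The sequent `{Δ}^w = {{⋯{Δ}^{aₙ}⋯}^{a₂}}^{a₁}` for a string `w = a₁ ⋯ aₙ`; it is `Δ` if `w` is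
empty. -/
def brackets : List α → NestedSeq α At → NestedSeq α At
  | [], Δ => Δ
  | a :: w, Δ => bracket a (brackets w Δ)

/-- Two representatives denote the same nested sequent: the equivalence relation generated by
exchanging adjacent entries, at any depth. -/
inductive Perm : NestedSeq α At → NestedSeq α At → Prop
  | refl (Γ) : Perm Γ Γ
  | symm {Γ Δ} : Perm Γ Δ → Perm Δ Γ
  | trans {Γ Δ Θ} : Perm Γ Δ → Perm Δ Θ → Perm Γ Θ
  | form (A) {Γ Γ'} : Perm Γ Γ' → Perm (form A Γ) (form A Γ')
  | br (a) {Δ Δ' Γ Γ'} : Perm Δ Δ' → Perm Γ Γ' → Perm (br a Δ Γ) (br a Δ' Γ')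
  | swapFormForm (A B Γ) : Perm (.form A (.form B Γ)) (.form B (.form A Γ))
  | swapFormBr (A a Δ Γ) : Perm (.form A (.br a Δ Γ)) (.br a Δ (.form A Γ))
  | swapBrBr (a Δ b Θ Γ) : Perm (.br a Δ (.br b Θ Γ)) (.br b Θ (.br a Δ Γ))

/-- The nodes of the tree of a nested sequent: the nodes of `{Δ}^a, Γ` are those of `Γ` (`outer`)
and those of `Δ` (`inner`), and adding a formula to `Γ` does not change the nodes. -/
inductive Node : NestedSeq α At → Type (max u v)
  | nil : Node nil
  | form {A : Form α At} {Γ : NestedSeq α At} (i : Node Γ) : Node (form A Γ)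
  | outer {a : α} {Δ Γ : NestedSeq α At} (i : Node Γ) : Node (br a Δ Γ)
  | inner {a : α} {Δ Γ : NestedSeq α At} (i : Node Δ) : Node (br a Δ Γ)

/-- There are finitely many nodes, so propagation automata have finitely many states. -/
instance (Γ : NestedSeq α At) : Finite (Node Γ) := by
  induction Γ with
  | nil => exact Finite.of_surjective (fun _ : Unit => Node.nil) (by rintro ⟨⟩; exact ⟨(), rfl⟩)
  | form A Γ ih =>
    refine Finite.of_surjective (Node.form (A := A) (Γ := Γ)) ?_
    intro k
    cases k with
    | form i => exact ⟨i, rfl⟩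
  | br a Δ Γ ihΔ ihΓ =>
    refine Finite.of_surjective
      (Sum.elim (Node.outer (a := a) (Δ := Δ) (Γ := Γ)) (Node.inner (a := a) (Δ := Δ) (Γ := Γ))) ?_
    intro k
    cases k with
    | outer i => exact ⟨.inl i, rfl⟩
    | inner i => exact ⟨.inr i, rfl⟩

/-- The root of the tree of a nested sequent. -/
def root : (Γ : NestedSeq α At) → Node Γ
  | .nil => .nil
  | .form _ Γ => .form (root Γ)
  | .br _ _ Γ => .outer (root Γ)

/-- `Edge Γ i b j`: in the tree of `Γ`, the node `j` is a child of the node `i`, and the edge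
from `i` to `j` is labelled with `b`. -/
def Edge : (Γ : NestedSeq α At) → Node Γ → α → Node Γ → Prop
  | .nil, _, _, _ => False
  | .form _ Γ, .form i, b, .form j => Edge Γ i b j
  | .br _ _ Γ, .outer i, b, .outer j => Edge Γ i b j
  | .br _ Δ _, .inner i, b, .inner j => Edge Δ i b j
  | .br a Δ Γ, .outer i, b, .inner j => i = root Γ ∧ b = a ∧ j = root Δ
  | .br _ _ _, .inner _, _, .outer _ => False

/-- A context `Γ[ ]_i` is given by a sequent `Γ` and the node `i` of the hole; `fill Γ i Δ` is
`Γ[Δ]_i`. -/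
def fill : (Γ : NestedSeq α At) → Node Γ → NestedSeq α At → NestedSeq α At
  | .nil, _, Θ => Θ
  | .form A Γ, .form i, Θ => .form A (fill Γ i Θ)
  | .br a Δ Γ, .outer i, Θ => .br a Δ (fill Γ i Θ)
  | .br a Δ Γ, .inner i, Θ => .br a (fill Δ i Θ) Γ

/-- A two-hole context `Γ[ ]_i[ ]_j` is given by a sequent `Γ` and the nodes `i` and `j` of the
holes, which may coincide; `fill₂ Γ i Θ j Ξ` is `Γ[Θ]_i[Ξ]_j`. -/
def fill₂ : (Γ : NestedSeq α At) → Node Γ → NestedSeq α At → Node Γ → NestedSeq α At →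
    NestedSeq α At
  | .nil, _, Θ, _, Ξ => Θ ++ Ξ
  | .form A Γ, .form i, Θ, .form j, Ξ => .form A (fill₂ Γ i Θ j Ξ)
  | .br a Δ Γ, .outer i, Θ, .outer j, Ξ => .br a Δ (fill₂ Γ i Θ j Ξ)
  | .br a Δ Γ, .inner i, Θ, .inner j, Ξ => .br a (fill₂ Δ i Θ j Ξ) Γ
  | .br a Δ Γ, .outer i, Θ, .inner j, Ξ => .br a (fill Δ j Ξ) (fill Γ i Θ)
  | .br a Δ Γ, .inner i, Θ, .outer j, Ξ => .br a (fill Δ i Θ) (fill Γ j Ξ)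

/-- The propagation automaton `R(Γ, i, j)`: its states are the nodes of `Γ`, it starts in `i` and
accepts in `j`, and an edge from `x` to `y` labelled with `c` yields a transition from `x` to `y`
on `c` and a transition from `y` to `x` on the converse of `c`. -/
def propAutomaton [ConverseAlphabet α] (Γ : NestedSeq α At) (i j : Node Γ) : NFA α (Node Γ) where
  step x b := {y | Edge Γ x b y ∨ ∃ c, Edge Γ y c x ∧ b = ConverseAlphabet.conv c}
  start := {i}
  accept := {j}

end NestedSeq

/-! ### The two calculi -/

section Calculi

open NestedSeq

variable {α : Type u} {At : Type v} [ConverseAlphabet α]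

/-- Provability of nested sequents in the shallow calculus `SKm(S)`. The constructor `exch` says
that nested sequents are multisets; the constructor `rho` gives the structural rules `ρ(S)`. -/
inductive SKm (S : SemiThue α) : NestedSeq α At → Prop
  | exch {Γ Δ} : Perm Γ Δ → SKm S Γ → SKm S Δ
  | id (Γ : NestedSeq α At) (p : At) : SKm S (Γ ++ single (.atom p) ++ single (.natom p))
  | cut {Γ Δ : NestedSeq α At} (A : Form α At) :
      SKm S (Γ ++ single A) → SKm S (Δ ++ single A.lneg) → SKm S (Γ ++ Δ)
  | ctr {Γ Δ : NestedSeq α At} : SKm S (Γ ++ Δ ++ Δ) → SKm S (Γ ++ Δ)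
  | wk {Γ : NestedSeq α At} (Δ : NestedSeq α At) : SKm S Γ → SKm S (Γ ++ Δ)
  | res {Γ Δ : NestedSeq α At} {a : α} :
      SKm S (Γ ++ bracket a Δ) → SKm S (bracket (ConverseAlphabet.conv a) Γ ++ Δ)
  | and {Γ : NestedSeq α At} {A B : Form α At} :
      SKm S (Γ ++ single A) → SKm S (Γ ++ single B) → SKm S (Γ ++ single (.and A B))
  | or {Γ : NestedSeq α At} {A B : Form α At} :
      SKm S (Γ ++ single A ++ single B) → SKm S (Γ ++ single (.or A B))
  | box {Γ : NestedSeq α At} {a : α} {A : Form α At} :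
      SKm S (Γ ++ bracket a (single A)) → SKm S (Γ ++ single (.box a A))
  | dia {Γ Δ : NestedSeq α At} {a : α} {A : Form α At} :
      SKm S (Γ ++ bracket a (Δ ++ single A)) → SKm S (Γ ++ bracket a Δ ++ single (.dia a A))
  | rho {Γ Δ : NestedSeq α At} {x y : List α} :
      (x, y) ∈ S → SKm S (brackets x Δ ++ Γ) → SKm S (brackets y Δ ++ Γ)

/-- Provability of nested sequents in the deep inference calculus `DKm(S)`. The constructor `exch`
says that nested sequents are multisets; the constructor `prop` gives the propagation rules
`p_S`. -/
inductive DKm (S : SemiThue α) : NestedSeq α At → Prop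
  | exch {Γ Δ} : Perm Γ Δ → DKm S Γ → DKm S Δ
  | id (Γ : NestedSeq α At) (i : Node Γ) (p : At) :
      DKm S (fill Γ i (single (.atom p) ++ single (.natom p)))
  | and {Γ : NestedSeq α At} {i : Node Γ} {A B : Form α At} :
      DKm S (fill Γ i (single (.and A B) ++ single A)) →
      DKm S (fill Γ i (single (.and A B) ++ single B)) →
      DKm S (fill Γ i (single (.and A B)))
  | or {Γ : NestedSeq α At} {i : Node Γ} {A B : Form α At} :
      DKm S (fill Γ i (single (.or A B) ++ single A ++ single B)) →
      DKm S (fill Γ i (single (.or A B)))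
  | box {Γ : NestedSeq α At} {i : Node Γ} {a : α} {A : Form α At} :
      DKm S (fill Γ i (single (.box a A) ++ bracket a (single A))) →
      DKm S (fill Γ i (single (.box a A)))
  | diaUp {Γ : NestedSeq α At} {i : Node Γ} {a : α} {A : Form α At} {Δ : NestedSeq α At} :
      DKm S (fill Γ i (bracket a (Δ ++ single A) ++ single (.dia a A))) →
      DKm S (fill Γ i (bracket a Δ ++ single (.dia a A)))
  | diaDown {Γ : NestedSeq α At} {i : Node Γ} {a : α} {A : Form α At} {Δ : NestedSeq α At} :
      DKm S (fill Γ i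
        (bracket a (Δ ++ single (.dia (ConverseAlphabet.conv a) A)) ++ single A)) →
      DKm S (fill Γ i (bracket a (Δ ++ single (.dia (ConverseAlphabet.conv a) A))))
  | prop {Γ : NestedSeq α At} {i j : Node Γ} {a : α} {A : Form α At} :
      (∃ w, w ∈ (propAutomaton Γ i j).accepts ∧ w ∈ S.lang a) →
      DKm S (fill₂ Γ i (single (.dia a A)) j (single A)) →
      DKm S (fill₂ Γ i (single (.dia a A)) j nil)

end Calculi

end GrammarLogic

/-!
The two calculi are equivalent because both are sound and complete for the same Kripke models: those
in which the relation of `ā` is the converse of the relation of `a`, and the composite relation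
along `y` is contained in that along `x` for every rule `x → y` of `S` (`Model`). A nested sequent
is read as a disjunction in which `{Δ}^a` stands for `[a]Δ`.

Soundness of `SKm(S)` is checked rule by rule. For `DKm(S)`, a filled context is false at a world
exactly when its tree can be mapped into the model so that the formulae at the nodes and the
fillings of the holes are false (`not_satSeq_fill_iff`, `not_satSeq_fill₂_iff`). Such a map turns a
walk labelled by a string of `L_a(S)` into a pair of worlds related by `a`, which gives the
propagation rules.

Completeness of `SKm(S)` uses a canonical model, whose worlds are maximal sets of formulae without
a provable finite part (`CanonicalWorld`). The rule (cut) decides every formula at every world, the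
display property given by (r) makes the relations of converse letters converse to each other
(`Rel.conv`), and the rule `ρ(S)` gives the inclusion for each rule of `S` (`rel_of_rule`).

`DKm(S)` has no cut, so its completeness is shown by saturation. Each rule read upwards adds
something to an unprovable sequent without making it provable, and since a sequent poses only
finitely many requirements, they can all be met in one extension (`exists_emb_meets_all`). Iterating
this yields an infinite chain of unprovable sequents. Its limit tree, whose nodes are represented
by threads through the chain, becomes a model when `s` and `t` are related by `a` if some walk from
`s` to `t` is labelled by a string of `L_a(S)`: closedness of `S` gives the converses, and
context-freeness gives the inclusions for the rules of `S`. Every formula at a node is false there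
(`not_sat_limitModel`).
-/

namespace GrammarLogic

universe u v w

open NestedSeq

/-! ### Relations along strings -/

/-- The composite of the relations `R a₁, …, R aₙ` along a string `a₁ ⋯ aₙ`. -/
def relStr {α : Type u} {W : Type w} (R : α → W → W → Prop) : List α → W → W → Prop
  | [], s, t => s = t
  | a :: x, s, t => ∃ r, R a s r ∧ relStr R x r t

section RelStr

variable {α : Type u} {W : Type w} {R : α → W → W → Prop}

theorem relStr_append {x y : List α} {s t : W} :
    relStr R (x ++ y) s t ↔ ∃ r, relStr R x s r ∧ relStr R y r t := by
  induction x generalizing s with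
  | nil => simp [relStr]
  | cons a x ih =>
    simp only [List.cons_append, relStr, ih]
    constructor
    · rintro ⟨r, h, q, h1, h2⟩
      exact ⟨q, ⟨r, h, h1⟩, h2⟩
    · rintro ⟨q, ⟨r, h, h1⟩, h2⟩
      exact ⟨r, h, q, h1, h2⟩

theorem relStr_singleton {a : α} {s t : W} : relStr R [a] s t ↔ R a s t := by
  simp [relStr]

theorem relStr_map {W' : Type*} {R' : α → W' → W' → Prop} (f : W → W')
    (hf : ∀ a s t, R a s t → R' a (f s) (f t)) {x : List α} {s t : W} (h : relStr R x s t) :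
    relStr R' x (f s) (f t) := by
  induction x generalizing s with
  | nil => exact congrArg f h
  | cons a x ih =>
    obtain ⟨r, h1, h2⟩ := h
    exact ⟨f r, hf _ _ _ h1, ih h2⟩

theorem relStr_convStr [ConverseAlphabet α]
    (hR : ∀ a s t, R a s t → R (ConverseAlphabet.conv a) t s) {x : List α} {s t : W}
    (h : relStr R x s t) : relStr R (convStr x) t s := by
  induction x generalizing s with
  | nil => exact Eq.symm h
  | cons a x ih =>
    obtain ⟨r, h1, h2⟩ := h
    have : convStr (a :: x) = convStr x ++ [ConverseAlphabet.conv a] := by simp [convStr]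
    rw [this, relStr_append]
    exact ⟨r, ih h2, relStr_singleton.2 (hR _ _ _ h1)⟩

end RelStr

/-! ### Models -/

/-- A Kripke model over an `S`-frame: converse letters are interpreted by converse relations, and
each rule `x → y` of `S` by the inclusion of the composite along `y` in the composite along
`x`. -/
structure Model {α : Type u} [ConverseAlphabet α] (S : SemiThue α) (At : Type v) where
  W : Type w
  rel : α → W → W → Prop
  val : At → W → Prop
  rel_conv : ∀ a s t, rel a s t → rel (ConverseAlphabet.conv a) t s
  rel_rule : ∀ x y, (x, y) ∈ S → ∀ s t, relStr rel y s t → relStr rel x s t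

namespace Model

variable {α : Type u} {At : Type v} [ConverseAlphabet α] {S : SemiThue α}

/-- Truth of a formula at a world. -/
def Sat (M : Model.{u, v, w} S At) : M.W → Form α At → Prop
  | s, .atom p => M.val p s
  | s, .natom p => ¬ M.val p s
  | s, .or A B => M.Sat s A ∨ M.Sat s B
  | s, .and A B => M.Sat s A ∧ M.Sat s B
  | s, .box a A => ∀ t, M.rel a s t → M.Sat t A
  | s, .dia a A => ∃ t, M.rel a s t ∧ M.Sat t A

/-- Truth of a nested sequent at a world: the comma is read as disjunction and `{Δ}^a` as
`[a]Δ`. -/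
def SatSeq (M : Model.{u, v, w} S At) : M.W → NestedSeq α At → Prop
  | _, .nil => False
  | s, .form A Γ => M.Sat s A ∨ M.SatSeq s Γ
  | s, .br a Δ Γ => (∀ t, M.rel a s t → M.SatSeq t Δ) ∨ M.SatSeq s Γ

variable (M : Model.{u, v, w} S At)

theorem sat_lneg {s : M.W} {A : Form α At} : M.Sat s A.lneg ↔ ¬ M.Sat s A := by
  induction A generalizing s with
  | atom p => simp [Form.lneg, Sat]
  | natom p => simp [Form.lneg, Sat]
  | or A B hA hB => simp [Form.lneg, Sat, hA, hB]
  | and A B hA hB => simp only [Form.lneg, Sat, hA, hB]; tauto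
  | box a A hA => simp [Form.lneg, Sat, hA]
  | dia a A hA => simp [Form.lneg, Sat, hA]

theorem satSeq_append {s : M.W} {Γ Δ : NestedSeq α At} :
    M.SatSeq s (Γ ++ Δ) ↔ M.SatSeq s Γ ∨ M.SatSeq s Δ := by
  change M.SatSeq s (append Γ Δ) ↔ _
  induction Γ with
  | nil => simp [append, SatSeq]
  | form A Γ ih => simp only [append, SatSeq, ih]; tauto
  | br a Θ Γ _ ih => simp only [append, SatSeq, ih]; tauto

theorem satSeq_single {s : M.W} {A : Form α At} : M.SatSeq s (single A) ↔ M.Sat s A := by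
  simp [single, SatSeq]

theorem satSeq_bracket {s : M.W} {a : α} {Δ : NestedSeq α At} :
    M.SatSeq s (bracket a Δ) ↔ ∀ t, M.rel a s t → M.SatSeq t Δ := by
  simp [bracket, SatSeq]

theorem satSeq_brackets {s : M.W} {x : List α} {Δ : NestedSeq α At} :
    M.SatSeq s (brackets x Δ) ↔ ∀ t, relStr M.rel x s t → M.SatSeq t Δ := by
  induction x generalizing s with
  | nil => simp [brackets, relStr]
  | cons a x ih =>
    simp only [brackets, satSeq_bracket, ih, relStr]
    constructor
    · rintro h t ⟨r, h1, h2⟩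
      exact h r h1 t h2
    · intro h r h1 t h2
      exact h t ⟨r, h1, h2⟩

theorem satSeq_perm {Γ Δ : NestedSeq α At} (h : Perm Γ Δ) (s : M.W) :
    M.SatSeq s Γ ↔ M.SatSeq s Δ := by
  induction h generalizing s with
  | refl => rfl
  | symm _ ih => exact (ih s).symm
  | trans _ _ ih1 ih2 => exact (ih1 s).trans (ih2 s)
  | form A _ ih => simp only [SatSeq, ih]
  | br a _ _ ih1 ih2 => simp only [SatSeq, ih1, ih2]
  | swapFormForm => simp only [SatSeq]; tauto
  | swapFormBr => simp only [SatSeq]; tauto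
  | swapBrBr => simp only [SatSeq]; tauto

theorem rel_conv_iff {a : α} {s t : M.W} :
    M.rel (ConverseAlphabet.conv a) s t ↔ M.rel a t s := by
  refine ⟨fun h => ?_, M.rel_conv a t s⟩
  have := M.rel_conv _ _ _ h
  rwa [ConverseAlphabet.conv_conv] at this

theorem relStr_of_derives {x y : List α} (h : S.Derives x y) {s t : M.W}
    (hy : relStr M.rel y s t) : relStr M.rel x s t := by
  induction h generalizing s t with
  | refl => exact hy
  | tail _ hstep ih =>
    obtain ⟨l, r, x', y', hxy, rfl, rfl⟩ := hstep
    apply ih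
    simp only [relStr_append] at hy ⊢
    obtain ⟨p, ⟨q, h1, h2⟩, h3⟩ := hy
    exact ⟨p, ⟨q, h1, M.rel_rule _ _ hxy _ _ h2⟩, h3⟩

end Model

/-! ### Soundness of the shallow calculus -/

theorem SKm.sound {α : Type u} {At : Type v} [ConverseAlphabet α] {S : SemiThue α}
    {Γ : NestedSeq α At} (h : SKm S Γ) (M : Model.{u, v, w} S At) (s : M.W) : M.SatSeq s Γ := by
  induction h generalizing s with
  | exch hp _ ih => exact (M.satSeq_perm hp s).1 (ih s)
  | id Γ p =>
    simp only [M.satSeq_append, M.satSeq_single, Model.Sat]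
    tauto
  | cut A _ _ ih1 ih2 =>
    have h1 := ih1 s
    have h2 := ih2 s
    simp only [M.satSeq_append, M.satSeq_single, M.sat_lneg] at h1 h2 ⊢
    tauto
  | ctr _ ih =>
    have h1 := ih s
    simp only [M.satSeq_append] at h1 ⊢
    tauto
  | wk Δ _ ih => exact M.satSeq_append.2 (Or.inl (ih s))
  | res _ ih =>
    simp only [M.satSeq_append, M.satSeq_bracket, M.rel_conv_iff] at ih ⊢
    by_contra hc
    push Not at hc
    obtain ⟨⟨t, ht, hΓ⟩, hΔ⟩ := hc
    exact (ih t).elim hΓ fun h => hΔ (h s ht)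
  | and _ _ ih1 ih2 =>
    have h1 := ih1 s
    have h2 := ih2 s
    simp only [M.satSeq_append, M.satSeq_single, Model.Sat] at h1 h2 ⊢
    tauto
  | or _ ih =>
    have h1 := ih s
    simp only [M.satSeq_append, M.satSeq_single, Model.Sat] at h1 ⊢
    tauto
  | box _ ih =>
    have h1 := ih s
    simpa only [M.satSeq_append, M.satSeq_single, M.satSeq_bracket, Model.Sat] using h1
  | dia _ ih =>
    have h1 := ih s
    simp only [M.satSeq_append, M.satSeq_single, M.satSeq_bracket, Model.Sat] at h1 ⊢
    by_contra hc
    push Not at hc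
    obtain ⟨⟨hΓ, t, ht, hΔ⟩, hA⟩ := hc
    exact h1.elim hΓ fun h => (h t ht).elim hΔ (hA t ht)
  | rho hxy _ ih =>
    have h1 := ih s
    simp only [M.satSeq_append, M.satSeq_brackets] at h1 ⊢
    exact h1.imp_left fun h t ht => h t (M.rel_rule _ _ hxy _ _ ht)

/-! ### Walks in the tree of a nested sequent -/

namespace NestedSeq

variable {α : Type u} {At : Type v} [ConverseAlphabet α]

/-- A transition of the propagation automaton: a tree edge read downwards, or read upwards on the
converse of its label. -/
def Trans (Γ : NestedSeq α At) (b : α) (i j : Node Γ) : Prop :=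
  Edge Γ i b j ∨ ∃ c, Edge Γ j c i ∧ b = ConverseAlphabet.conv c

theorem Trans.conv {Γ : NestedSeq α At} {b : α} {i j : Node Γ} (h : Γ.Trans b i j) :
    Γ.Trans (ConverseAlphabet.conv b) j i := by
  rcases h with h | ⟨c, h, rfl⟩
  · exact Or.inr ⟨b, h, rfl⟩
  · exact Or.inl (by rwa [ConverseAlphabet.conv_conv])

theorem mem_accepts_propAutomaton {Γ : NestedSeq α At} {i j : Node Γ} {x : List α} :
    x ∈ (propAutomaton Γ i j).accepts ↔ relStr Γ.Trans x i j := by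
  have key : ∀ (T : Set (Node Γ)) (x : List α) (k : Node Γ),
      k ∈ (propAutomaton Γ i j).evalFrom T x ↔ ∃ t ∈ T, relStr Γ.Trans x t k := by
    intro T x k
    induction x generalizing T with
    | nil => simp [relStr]
    | cons b x ih =>
      rw [NFA.evalFrom_cons, ih]
      simp only [NFA.mem_stepSet, relStr]
      constructor
      · rintro ⟨r, ⟨t, ht, hr⟩, h⟩
        exact ⟨t, ht, r, hr, h⟩
      · rintro ⟨t, ht, r, hr, h⟩
        exact ⟨r, ⟨t, ht, hr⟩, h⟩
  rw [NFA.mem_accepts]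
  simp only [key]
  simp [propAutomaton]

end NestedSeq

/-! ### Soundness of the deep calculus -/

namespace Model

section NodeFun

variable {α : Type u} {At : Type v}

theorem exists_node_form_fun {W : Type*} {A : Form α At} {Γ : NestedSeq α At}
    {p : (Node (.form A Γ) → W) → Prop} :
    (∃ f, p f) ↔ ∃ g : Node Γ → W, p fun | .form i => g i := by
  refine ⟨fun ⟨f, hf⟩ => ⟨fun i => f (.form i), ?_⟩, fun ⟨g, hg⟩ => ⟨_, hg⟩⟩
  convert hf using 2 with k
  cases k; rfl

theorem exists_node_br_fun {W : Type*} {a : α} {Δ Γ : NestedSeq α At}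
    {p : (Node (.br a Δ Γ) → W) → Prop} :
    (∃ f, p f) ↔ ∃ (g : Node Γ → W) (h : Node Δ → W), p fun
      | .outer i => g i
      | .inner i => h i := by
  refine ⟨fun ⟨f, hf⟩ => ⟨fun i => f (.outer i), fun i => f (.inner i), ?_⟩,
    fun ⟨g, h, hg⟩ => ⟨_, hg⟩⟩
  convert hf using 2 with k
  cases k <;> rfl

end NodeFun

variable {α : Type u} {At : Type v} [ConverseAlphabet α] {S : SemiThue α}
  (M : Model.{u, v, w} S At)

/-- `M.Refutes Γ f`: the assignment `f` of worlds to the nodes of `Γ` sends tree edges to pairs of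
related worlds, and every formula at a node of `Γ` is false at the world of that node. -/
def Refutes : (Γ : NestedSeq α At) → (Node Γ → M.W) → Prop
  | .nil, _ => True
  | .form A Γ, f => ¬ M.Sat (f (.form (root Γ))) A ∧ Refutes Γ fun i => f (.form i)
  | .br a Δ Γ, f => M.rel a (f (.outer (root Γ))) (f (.inner (root Δ))) ∧
      (Refutes Δ fun i => f (.inner i)) ∧ Refutes Γ fun i => f (.outer i)

variable {M}

theorem Refutes.rel {Γ : NestedSeq α At} {f : Node Γ → M.W} (hf : M.Refutes Γ f) {i j : Node Γ}
    {b : α} (h : Edge Γ i b j) : M.rel b (f i) (f j) := by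
  induction Γ with
  | nil => simp [Edge] at h
  | form A Γ ih =>
    cases i with | form i => cases j with | form j => exact ih hf.2 h
  | br a Δ Γ ihΔ ihΓ =>
    cases i with
    | outer i =>
      cases j with
      | outer j => exact ihΓ hf.2.2 h
      | inner j =>
        obtain ⟨rfl, rfl, rfl⟩ := h
        exact hf.1
    | inner i =>
      cases j with
      | outer j => exact False.elim h
      | inner j => exact ihΔ hf.2.1 h

theorem Refutes.relStr {Γ : NestedSeq α At} {f : Node Γ → M.W} (hf : M.Refutes Γ f)
    {i j : Node Γ} {x : List α} (h : relStr Γ.Trans x i j) : relStr M.rel x (f i) (f j) := by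
  refine relStr_map f ?_ h
  rintro b s t (h | ⟨c, h, rfl⟩)
  · exact hf.rel h
  · exact M.rel_conv _ _ _ (hf.rel h)

theorem not_satSeq_iff {Γ : NestedSeq α At} {s : M.W} :
    ¬ M.SatSeq s Γ ↔ ∃ f : Node Γ → M.W, f (root Γ) = s ∧ M.Refutes Γ f := by
  induction Γ generalizing s with
  | nil => exact iff_of_true id ⟨fun _ => s, rfl, trivial⟩
  | form A Γ ih =>
    simp only [exists_node_form_fun, SatSeq, not_or, ih, Refutes, root]
    grind
  | br a Δ Γ ihΔ ihΓ =>
    simp only [exists_node_br_fun, SatSeq, not_or, not_forall, ihΔ, ihΓ, Refutes, root]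
    grind

/-- A filled context is false at `s` exactly when the context is refuted by an assignment that
sends the root to `s` and under which the filling is false at the hole. -/
theorem not_satSeq_fill_iff {Γ : NestedSeq α At} {i : Node Γ} {Θ : NestedSeq α At} {s : M.W} :
    ¬ M.SatSeq s (fill Γ i Θ) ↔
      ∃ f : Node Γ → M.W, f (root Γ) = s ∧ M.Refutes Γ f ∧ ¬ M.SatSeq (f i) Θ := by
  induction Γ generalizing s with
  | nil =>
    cases i
    exact ⟨fun h => ⟨fun _ => s, rfl, trivial, h⟩, by rintro ⟨f, rfl, -, h⟩; exact h⟩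
  | form A Γ ih =>
    cases i with
    | form i =>
      simp only [exists_node_form_fun, fill, SatSeq, not_or, ih, Refutes, root]
      grind
  | br a Δ Γ ihΔ ihΓ =>
    cases i <;>
      simp only [exists_node_br_fun, fill, SatSeq, not_or, not_forall, ihΔ, ihΓ, not_satSeq_iff,
        Refutes, root] <;>
      grind

theorem not_satSeq_fill₂_iff {Γ : NestedSeq α At} {i j : Node Γ} {Θ Ξ : NestedSeq α At}
    {s : M.W} :
    ¬ M.SatSeq s (fill₂ Γ i Θ j Ξ) ↔
      ∃ f : Node Γ → M.W, f (root Γ) = s ∧ M.Refutes Γ f ∧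
        ¬ M.SatSeq (f i) Θ ∧ ¬ M.SatSeq (f j) Ξ := by
  induction Γ generalizing s with
  | nil =>
    cases i
    cases j
    simp only [fill₂, M.satSeq_append, not_or]
    exact ⟨fun h => ⟨fun _ => s, rfl, trivial, h⟩, by rintro ⟨f, rfl, -, h⟩; exact h⟩
  | form A Γ ih =>
    cases i with
    | form i =>
      cases j with
      | form j =>
        simp only [exists_node_form_fun, fill₂, SatSeq, not_or, ih, Refutes, root]
        grind
  | br a Δ Γ ihΔ ihΓ =>
    cases i <;> cases j <;>
      simp only [exists_node_br_fun, fill₂, SatSeq, not_or, not_forall, ihΔ, ihΓ,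
        not_satSeq_iff (Γ := Γ), not_satSeq_iff (Γ := Δ), not_satSeq_fill_iff, Refutes, root] <;>
      grind

end Model

theorem DKm.sound {α : Type u} {At : Type v} [ConverseAlphabet α] {S : SemiThue α}
    {Γ : NestedSeq α At} (h : DKm S Γ) (M : Model.{u, v, w} S At) (s : M.W) : M.SatSeq s Γ := by
  induction h generalizing s with
  | exch hp _ ih => exact (M.satSeq_perm hp s).1 (ih s)
  | id Γ i p =>
    by_contra hc
    obtain ⟨f, rfl, hf, h⟩ := Model.not_satSeq_fill_iff.1 hc
    simp only [M.satSeq_append, M.satSeq_single, Model.Sat] at h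
    tauto
  | and _ _ ih1 ih2 =>
    by_contra hc
    obtain ⟨f, rfl, hf, h⟩ := Model.not_satSeq_fill_iff.1 hc
    have h1 := fun hn => Model.not_satSeq_fill_iff.2 ⟨f, rfl, hf, hn⟩ (ih1 _)
    have h2 := fun hn => Model.not_satSeq_fill_iff.2 ⟨f, rfl, hf, hn⟩ (ih2 _)
    simp only [M.satSeq_append, M.satSeq_single, Model.Sat] at h h1 h2
    tauto
  | or _ ih =>
    by_contra hc
    obtain ⟨f, rfl, hf, h⟩ := Model.not_satSeq_fill_iff.1 hc
    have h1 := fun hn => Model.not_satSeq_fill_iff.2 ⟨f, rfl, hf, hn⟩ (ih _)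
    simp only [M.satSeq_append, M.satSeq_single, Model.Sat] at h h1
    tauto
  | box _ ih =>
    by_contra hc
    obtain ⟨f, rfl, hf, h⟩ := Model.not_satSeq_fill_iff.1 hc
    have h1 := fun hn => Model.not_satSeq_fill_iff.2 ⟨f, rfl, hf, hn⟩ (ih _)
    simp only [M.satSeq_append, M.satSeq_single, M.satSeq_bracket, Model.Sat] at h h1
    tauto
  | diaUp _ ih =>
    by_contra hc
    obtain ⟨f, rfl, hf, h⟩ := Model.not_satSeq_fill_iff.1 hc
    refine Model.not_satSeq_fill_iff.2 ⟨f, rfl, hf, ?_⟩ (ih _)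
    simp only [M.satSeq_append, M.satSeq_single, M.satSeq_bracket, Model.Sat] at h ⊢
    grind
  | diaDown _ ih =>
    by_contra hc
    obtain ⟨f, rfl, hf, h⟩ := Model.not_satSeq_fill_iff.1 hc
    refine Model.not_satSeq_fill_iff.2 ⟨f, rfl, hf, ?_⟩ (ih _)
    simp only [M.satSeq_append, M.satSeq_single, M.satSeq_bracket, Model.Sat, M.rel_conv_iff]
      at h ⊢
    grind
  | prop hw _ ih =>
    by_contra hc
    obtain ⟨f, rfl, hf, hi, hj⟩ := Model.not_satSeq_fill₂_iff.1 hc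
    refine Model.not_satSeq_fill₂_iff.2 ⟨f, rfl, hf, hi, ?_⟩ (ih _)
    obtain ⟨x, hx, hxa⟩ := hw
    simp only [M.satSeq_single, Model.Sat, not_exists, not_and] at hi ⊢
    exact hi _ (relStr_singleton.1
      (M.relStr_of_derives hxa (hf.relStr (mem_accepts_propAutomaton.1 hx))))

/-! ### Derived rules of the shallow calculus -/

namespace NestedSeq

variable {α : Type u} {At : Type v}

theorem append_nil (Γ : NestedSeq α At) : Γ ++ nil = Γ := by
  change append Γ nil = Γ
  induction Γ with
  | nil => rfl
  | form A Γ ih => simp only [append, ih]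
  | br a Δ Γ _ ih => simp only [append, ih]

theorem append_assoc (Γ Δ Θ : NestedSeq α At) : Γ ++ Δ ++ Θ = Γ ++ (Δ ++ Θ) := by
  change append (append Γ Δ) Θ = append Γ (append Δ Θ)
  induction Γ with
  | nil => rfl
  | form A Γ ih => simp only [append, ih]
  | br a Δ Γ _ ih => simp only [append, ih]

theorem Perm.append_left (Θ : NestedSeq α At) {Γ Δ : NestedSeq α At} (h : Perm Γ Δ) :
    Perm (Θ ++ Γ) (Θ ++ Δ) := by
  change Perm (append Θ Γ) (append Θ Δ)
  induction Θ with
  | nil => exact h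
  | form A Θ ih => exact .form A ih
  | br a _ Θ _ ih => exact .br a (.refl _) ih

theorem Perm.form_append (A : Form α At) (Γ Δ : NestedSeq α At) :
    Perm (.form A (Γ ++ Δ)) (Γ ++ .form A Δ) := by
  change Perm (.form A (append Γ Δ)) (append Γ (.form A Δ))
  induction Γ with
  | nil => exact .refl _
  | form B Γ ih => exact (Perm.swapFormForm _ _ _).trans (.form B ih)
  | br a _ Γ _ ih => exact (Perm.swapFormBr _ _ _ _).trans (.br a (.refl _) ih)

theorem Perm.br_append (a : α) (Θ Γ Δ : NestedSeq α At) :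
    Perm (.br a Θ (Γ ++ Δ)) (Γ ++ .br a Θ Δ) := by
  change Perm (.br a Θ (append Γ Δ)) (append Γ (.br a Θ Δ))
  induction Γ with
  | nil => exact .refl _
  | form B Γ ih => exact (Perm.swapFormBr _ _ _ _).symm.trans (.form B ih)
  | br b _ Γ _ ih => exact (Perm.swapBrBr _ _ _ _ _).trans (.br b (.refl _) ih)

theorem Perm.append_comm (Γ Δ : NestedSeq α At) : Perm (Γ ++ Δ) (Δ ++ Γ) := by
  induction Γ with
  | nil => rw [append_nil]; exact .refl _
  | form A Γ ih => exact (Perm.form A ih).trans (.form_append _ _ _)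
  | br a Θ Γ _ ih => exact (Perm.br a (.refl _) ih).trans (.br_append _ _ _ _)

/-- The sequent of a list of formulae. -/
def ofList (L : List (Form α At)) : NestedSeq α At :=
  L.foldr .form nil

theorem ofList_append (L L' : List (Form α At)) : ofList (L ++ L') = ofList L ++ ofList L' := by
  induction L with
  | nil => rfl
  | cons A L ih => exact congrArg (NestedSeq.form A) ih

theorem ofList_perm {L L' : List (Form α At)} (h : L.Perm L') : Perm (ofList L) (ofList L') := by
  induction h with
  | nil => exact .refl _
  | cons A _ ih => exact .form A ih
  | swap A B L => exact .swapFormForm _ _ _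
  | trans _ _ ih1 ih2 => exact ih1.trans ih2

end NestedSeq

namespace SKm

variable {α : Type u} {At : Type v} [ConverseAlphabet α] {S : SemiThue α}

theorem comm {Γ Δ : NestedSeq α At} (h : SKm S (Γ ++ Δ)) : SKm S (Δ ++ Γ) :=
  .exch (.append_comm _ _) h

/-- The display property: a structure can be moved to the root by turning its surroundings inside
out. -/
theorem bracket_append_iff {a : α} {Γ Δ : NestedSeq α At} :
    SKm S (Γ ++ bracket a Δ) ↔ SKm S (Δ ++ bracket (ConverseAlphabet.conv a) Γ) := by
  refine ⟨fun h => comm (.res h), fun h => ?_⟩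
  have := comm (SKm.res h)
  rwa [ConverseAlphabet.conv_conv] at this

/-- Necessitation: an instance of the display property with empty surroundings. -/
theorem nec {a : α} {Γ : NestedSeq α At} (h : SKm S Γ) : SKm S (bracket a Γ) :=
  bracket_append_iff (Γ := .nil).2 (h.wk _)

theorem right_comm {Γ Δ Θ : NestedSeq α At} (h : SKm S (Γ ++ Δ ++ Θ)) :
    SKm S (Γ ++ Θ ++ Δ) := by
  rw [append_assoc] at h ⊢
  exact .exch (.append_left _ (.append_comm _ _)) h

theorem mid_comm {Γ Δ Θ Ξ : NestedSeq α At} (h : SKm S (Γ ++ Δ ++ Θ ++ Ξ)) :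
    SKm S (Γ ++ Θ ++ Δ ++ Ξ) := by
  have h1 : SKm S (Ξ ++ Γ ++ Δ ++ Θ) := by
    simpa only [append_assoc] using comm h
  have h2 : SKm S (Ξ ++ (Γ ++ Θ ++ Δ)) := by
    simpa only [append_assoc] using right_comm h1
  exact comm h2

/-- Identity for arbitrary formulae. -/
theorem identity (A : Form α At) (Γ : NestedSeq α At) :
    SKm S (Γ ++ single A ++ single A.lneg) := by
  induction A generalizing Γ with
  | atom p => exact .id Γ p
  | natom p => exact right_comm (.id Γ p)
  | or A B hA hB =>
    exact .and (right_comm (.or ((right_comm (hA Γ)).wk _)))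
      (right_comm (.or (right_comm ((right_comm (hB Γ)).wk _))))
  | and A B hA hB =>
    exact .or (mid_comm (right_comm
      (.and (right_comm ((right_comm (hA Γ)).wk _)) (right_comm (hB _)))))
  | box a A hA =>
    exact right_comm (.box (right_comm (.dia (comm ((nec (hA .nil)).wk _)))))
  | dia a A hA =>
    exact .box (right_comm (.dia (comm ((nec (comm (hA .nil))).wk _))))

/-- The rule `⟨a⟩` for several formulae at once. -/
theorem dia_list {a : α} {Γ Δ : NestedSeq α At} (L : List (Form α At))
    (h : SKm S (Γ ++ bracket a (Δ ++ ofList L))) :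
    SKm S (Γ ++ bracket a Δ ++ ofList (L.map (.dia a))) := by
  induction L generalizing Δ with
  | nil =>
    simp only [List.map_nil, ofList, List.foldr_nil, append_nil] at h ⊢
    exact h
  | cons A L ih =>
    change SKm S (Γ ++ bracket a (Δ ++ (single A ++ ofList L))) at h
    rw [← append_assoc] at h
    change SKm S (Γ ++ bracket a Δ ++ (single (.dia a A) ++ ofList (L.map (.dia a))))
    rw [← append_assoc]
    exact right_comm (mid_comm (.dia (right_comm (ih h))))

/-- The formula `[a₁] ⋯ [aₙ] A` for a string `a₁ ⋯ aₙ`. -/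
def _root_.GrammarLogic.Form.boxes (x : List α) (A : Form α At) : Form α At :=
  x.foldr .box A

/-- By the display property, the rule `[a]` applies below brackets. -/
theorem boxes {x : List α} {A : Form α At} {Γ : NestedSeq α At}
    (h : SKm S (Γ ++ brackets x (single A))) : SKm S (Γ ++ single (Form.boxes x A)) := by
  induction x generalizing Γ with
  | nil => exact h
  | cons a x ih => exact .box (bracket_append_iff.2 (comm (ih (comm (bracket_append_iff.1 h)))))

/-- Weakening and contraction of formulae at the root. -/
theorem ofList_subset {L L' : List (Form α At)} {Γ : NestedSeq α At} (h : L ⊆ L')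
    (hL : SKm S (Γ ++ ofList L)) : SKm S (Γ ++ ofList L') := by
  induction L generalizing Γ with
  | nil => exact (append_nil Γ ▸ hL : SKm S Γ).wk _
  | cons A L ih =>
    obtain ⟨hA, hL'⟩ := List.cons_subset.1 h
    obtain ⟨L₁, L₂, rfl⟩ := List.append_of_mem hA
    have hp : Perm (ofList (A :: (L₁ ++ L₂))) (ofList (L₁ ++ A :: L₂)) :=
      ofList_perm List.perm_middle.symm
    have h1 : SKm S (Γ ++ single A ++ ofList (L₁ ++ A :: L₂)) :=
      ih hL' (by rw [append_assoc]; exact hL)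
    have h2 : SKm S (Γ ++ single A ++ (single A ++ ofList (L₁ ++ L₂))) :=
      .exch (.append_left _ hp.symm) h1
    rw [← append_assoc] at h2
    have h3 : SKm S (Γ ++ ofList (L₁ ++ L₂) ++ single A) :=
      .ctr (right_comm (mid_comm (right_comm h2)))
    have h4 := right_comm h3
    rw [append_assoc] at h4
    exact .exch (.append_left _ hp) h4

end SKm

/-! ### Completeness of the shallow calculus -/

section Canonical

variable {α : Type u} {At : Type v} [ConverseAlphabet α] {S : SemiThue α}

/-- `SKm.Der S X Γ`: the sequent `Γ` becomes provable when finitely many formulae from `X` are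
added to it. -/
def SKm.Der (S : SemiThue α) (X : Set (Form α At)) (Γ : NestedSeq α At) : Prop :=
  ∃ L : List (Form α At), (∀ B ∈ L, B ∈ X) ∧ SKm S (Γ ++ ofList L)

/-- The worlds of the canonical model: the maximal sets of formulae no finite part of which is a
provable sequent. The formulae in such a set are the ones that are false at the world. -/
abbrev CanonicalWorld (S : SemiThue α) (At : Type v) : Type (max u v) :=
  {X : Set (Form α At) // Maximal (fun X => ¬ SKm.Der S X .nil) X}

theorem exists_canonicalWorld {X : Set (Form α At)} (hX : ¬ SKm.Der S X .nil) :
    ∃ Y : CanonicalWorld S At, X ⊆ Y.1 := by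
  suffices h : _ from
    let ⟨Y, hXY, hY⟩ := zorn_subset_nonempty {X : Set (Form α At) | ¬ SKm.Der S X .nil} h X hX
    ⟨⟨Y, hY⟩, hXY⟩
  rintro c hc hchain ⟨Z, hZ⟩
  refine ⟨⋃₀ c, ?_, fun s hs => Set.subset_sUnion_of_mem hs⟩
  rintro ⟨L, hL, hd⟩
  have : ∃ Y ∈ c, ∀ B ∈ L, B ∈ Y := by
    clear hd
    induction L with
    | nil => exact ⟨Z, hZ, by simp⟩
    | cons A L ih =>
      obtain ⟨Y, hY, hLY⟩ := ih fun B hB => hL B (List.mem_cons_of_mem _ hB)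
      obtain ⟨Y', hY', hA⟩ := hL A List.mem_cons_self
      rcases hchain.total hY hY' with h | h
      · exact ⟨Y', hY', List.forall_mem_cons.2 ⟨hA, fun B hB => h (hLY B hB)⟩⟩
      · exact ⟨Y, hY, List.forall_mem_cons.2 ⟨h hA, hLY⟩⟩
  obtain ⟨Y, hY, hLY⟩ := this
  exact hc hY ⟨L, hLY, hd⟩

namespace CanonicalWorld

variable (X : CanonicalWorld S At)

theorem not_derivable {L : List (Form α At)} (hL : ∀ B ∈ L, B ∈ X.1) (h : SKm S (ofList L)) :
    False :=
  X.2.prop ⟨L, hL, h⟩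

theorem der_of_notMem {A : Form α At} (hA : A ∉ X.1) : SKm.Der S X.1 (single A) := by
  classical
  have h : SKm.Der S (insert A X.1) .nil := by
    by_contra hc
    exact hA (X.2.le_of_ge hc (Set.subset_insert A X.1) (Set.mem_insert A X.1))
  obtain ⟨L, hL, hd⟩ := h
  refine ⟨L.filter (· ≠ A), fun B hB => ?_, ?_⟩
  · simp only [List.mem_filter, decide_eq_true_eq] at hB
    exact (hL B hB.1).resolve_left hB.2
  · refine SKm.ofList_subset (Γ := .nil) (L := L) (L' := A :: L.filter (· ≠ A)) ?_ hd
    intro B hB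
    by_cases h : B = A <;> simp [h, hB]

/-- This is where (cut) is used. -/
theorem mem_or_lneg_mem (A : Form α At) : A ∈ X.1 ∨ A.lneg ∈ X.1 := by
  by_contra hc
  rw [not_or] at hc
  obtain ⟨L, hL, h⟩ := X.der_of_notMem hc.1
  obtain ⟨L', hL', h'⟩ := X.der_of_notMem hc.2
  refine X.not_derivable (L := L ++ L') ?_ ?_
  · simp only [List.mem_append]
    rintro B (hB | hB)
    exacts [hL B hB, hL' B hB]
  · rw [ofList_append]
    exact .cut A (SKm.comm h) (SKm.comm h')

theorem not_mem_and_lneg_mem {A : Form α At} (h : A ∈ X.1) (h' : A.lneg ∈ X.1) : False :=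
  X.not_derivable (L := [A, A.lneg]) (by simp [h, h']) (SKm.identity A .nil)

theorem mem_of_or_mem {A B : Form α At} (h : Form.or A B ∈ X.1) : A ∈ X.1 ∧ B ∈ X.1 := by
  constructor
  all_goals
    by_contra hc
    obtain ⟨L, hL, hd⟩ := X.der_of_notMem hc
    refine X.not_derivable (L := .or A B :: L) (List.forall_mem_cons.2 ⟨h, hL⟩) ?_
    refine SKm.comm (Γ := ofList L) (Δ := single (.or A B)) (.or ?_)
  · exact (SKm.comm hd).wk _
  · exact SKm.right_comm ((SKm.comm hd).wk _)

theorem mem_or_mem_of_and_mem {A B : Form α At} (h : Form.and A B ∈ X.1) :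
    A ∈ X.1 ∨ B ∈ X.1 := by
  by_contra hc
  rw [not_or] at hc
  obtain ⟨L, hL, hd⟩ := X.der_of_notMem hc.1
  obtain ⟨L', hL', hd'⟩ := X.der_of_notMem hc.2
  refine X.not_derivable (L := .and A B :: (L ++ L')) ?_ ?_
  · simp only [List.mem_cons, List.mem_append]
    rintro C (rfl | hC | hC)
    exacts [h, hL C hC, hL' C hC]
  · refine SKm.comm (Γ := ofList (L ++ L')) (Δ := single (.and A B)) (.and ?_ ?_)
    · exact SKm.comm (SKm.ofList_subset (List.subset_append_left _ _) hd)
    · exact SKm.comm (SKm.ofList_subset (List.subset_append_right _ _) hd')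

/-- Accessibility in the canonical model. -/
def Rel (a : α) (X Y : CanonicalWorld S At) : Prop :=
  ∀ B, Form.dia a B ∈ X.1 → B ∈ Y.1

theorem exists_rel_of_box_mem {a : α} {A : Form α At} (h : Form.box a A ∈ X.1) :
    ∃ Y : CanonicalWorld S At, Rel a X Y ∧ A ∈ Y.1 := by
  classical
  have hcons : ¬ SKm.Der S (insert A {B | Form.dia a B ∈ X.1}) .nil := by
    rintro ⟨L, hL, hd⟩
    set L₀ := L.filter (fun B => Form.dia a B ∈ X.1) with hL₀
    refine X.not_derivable (L := .box a A :: L₀.map (.dia a)) ?_ ?_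
    · simp only [List.mem_cons, List.mem_map]
      rintro C (rfl | ⟨B, hB, rfl⟩)
      · exact h
      · simpa using (List.mem_filter.1 hB).2
    · have h1 : SKm S (single A ++ ofList L₀) := by
        refine SKm.ofList_subset (Γ := .nil) (L' := A :: L₀) (fun B hB => ?_) hd
        rcases hL B hB with rfl | hB'
        · exact List.mem_cons_self
        · exact List.mem_cons_of_mem _ (List.mem_filter.2 ⟨hB, by simpa using hB'⟩)
      exact SKm.comm (Δ := single (.box a A))
        (.box (SKm.comm (SKm.dia_list (Γ := .nil) L₀ (SKm.nec h1))))
  obtain ⟨Y, hY⟩ := exists_canonicalWorld hcons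
  exact ⟨Y, fun B hB => hY (Set.mem_insert_of_mem _ hB), hY (Set.mem_insert _ _)⟩

variable {X}

theorem Rel.conv {a : α} {Y : CanonicalWorld S At} (h : Rel a X Y) :
    Rel (ConverseAlphabet.conv a) Y X := by
  intro B hB
  by_contra hBX
  have hB' : B.lneg ∈ X.1 := (X.mem_or_lneg_mem B).resolve_left hBX
  rcases X.mem_or_lneg_mem (.box a (.dia (ConverseAlphabet.conv a) B)) with hC | hC
  · -- The sequent `B.lneg, [a]⟨ā⟩B` is provable.
    refine X.not_derivable (L := [B.lneg, .box a (.dia (ConverseAlphabet.conv a) B)])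
      (by simp [hC, hB']) ?_
    refine SKm.box (Γ := single B.lneg) (SKm.bracket_append_iff.2 ?_)
    refine SKm.comm (SKm.dia (Γ := .nil) ?_)
    exact SKm.nec (SKm.comm (SKm.identity B .nil))
  · exact Y.not_mem_and_lneg_mem hB (h _ hC)

theorem lneg_mem_of_relStr {x : List α} {A : Form α At} {Y : CanonicalWorld S At}
    (h : relStr Rel x X Y) (hA : (Form.boxes x A).lneg ∈ X.1) : A.lneg ∈ Y.1 := by
  induction x generalizing X with
  | nil => obtain rfl : X = Y := h; exact hA
  | cons a x ih =>
    obtain ⟨Z, h1, h2⟩ := h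
    exact ih h2 (h1 _ hA)

theorem rel_of_rule {a : α} {y : List α} (hy : ([a], y) ∈ S) {Y : CanonicalWorld S At}
    (h : relStr Rel y X Y) : Rel a X Y := by
  intro B hB
  by_contra hBY
  have hB' : B.lneg ∈ Y.1 := (Y.mem_or_lneg_mem B).resolve_left hBY
  rcases X.mem_or_lneg_mem (Form.boxes y B.lneg) with hC | hC
  · -- The sequent `⟨a⟩B, [y] B.lneg` is provable, by one application of `ρ(S)`.
    refine X.not_derivable (L := [.dia a B, Form.boxes y B.lneg]) (by simp [hC, hB]) ?_
    refine SKm.boxes (Γ := single (.dia a B)) (SKm.comm (.rho hy ?_))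
    exact SKm.dia (Γ := .nil) (SKm.nec (SKm.comm (SKm.identity B .nil)))
  · exact Y.not_mem_and_lneg_mem hB' (lneg_mem_of_relStr h hC)

end CanonicalWorld

/-- The canonical model of `SKm(S)`. -/
def canonicalModel (At : Type v) (hcf : S.ContextFree) : Model.{u, v, max u v} S At where
  W := CanonicalWorld S At
  rel := CanonicalWorld.Rel
  val p X := Form.atom p ∉ X.1
  rel_conv _ _ _ h := h.conv
  rel_rule x y hxy s t h := by
    obtain ⟨a, rfl⟩ := hcf x y hxy
    exact relStr_singleton.2 (CanonicalWorld.rel_of_rule hxy h)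

/-- Truth lemma: the formulae in a world of the canonical model are false there. -/
theorem not_sat_canonicalModel (hcf : S.ContextFree) {A : Form α At} {X : CanonicalWorld S At}
    (h : A ∈ X.1) : ¬ (canonicalModel At hcf).Sat X A := by
  induction A generalizing X with
  | atom p => exact not_not_intro h
  | natom p => exact fun hp => hp fun hp' => X.not_mem_and_lneg_mem hp' h
  | or A B hA hB =>
    obtain ⟨h1, h2⟩ := X.mem_of_or_mem h
    exact not_or.2 ⟨hA h1, hB h2⟩
  | and A B hA hB =>
    rcases X.mem_or_mem_of_and_mem h with h | h
    exacts [fun hs => hA h hs.1, fun hs => hB h hs.2]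
  | box a A hA =>
    obtain ⟨Y, hXY, hY⟩ := X.exists_rel_of_box_mem h
    exact fun hs => hA hY (hs Y hXY)
  | dia a A hA =>
    rintro ⟨Y, hXY, hY⟩
    exact hA (hXY _ h) hY

theorem SKm.complete (hcf : S.ContextFree) {A : Form α At}
    (h : ∀ (M : Model.{u, v, max u v} S At) (s : M.W), M.Sat s A) : SKm S (single A) := by
  by_contra hA
  have hcons : ¬ SKm.Der S {A} .nil := by
    rintro ⟨L, hL, hd⟩
    exact hA (SKm.ofList_subset (Γ := .nil) (L' := [A]) (fun B hB => by simpa using hL B hB) hd)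
  obtain ⟨X, hX⟩ := exists_canonicalWorld hcons
  exact not_sat_canonicalModel hcf (hX rfl) (h (canonicalModel At hcf) X)

end Canonical

/-! ### Formulae at the nodes of a nested sequent -/

namespace NestedSeq

variable {α : Type u} {At : Type v}

/-- `Γ.Holds i B`: the formula `B` occurs at the node `i` of `Γ`. -/
def Holds : (Γ : NestedSeq α At) → Node Γ → Form α At → Prop
  | .nil, _, _ => False
  | .form A Γ, .form i, B => (i = root Γ ∧ B = A) ∨ Holds Γ i B
  | .br _ _ Γ, .outer i, B => Holds Γ i B
  | .br _ Δ _, .inner i, B => Holds Δ i B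

theorem finite_holds (Γ : NestedSeq α At) (i : Node Γ) : {B | Γ.Holds i B}.Finite := by
  induction Γ with
  | nil => cases i; exact Set.finite_empty
  | form A Γ ih =>
    cases i with
    | form i =>
      refine ((ih i).insert A).subset ?_
      rintro B (⟨-, rfl⟩ | hB)
      exacts [Set.mem_insert _ _, Set.mem_insert_of_mem _ hB]
  | br a Δ Γ ihΔ ihΓ =>
    cases i with
    | outer i => exact ihΓ i
    | inner i => exact ihΔ i

/-- An embedding of `Γ` into `Γ'`: a map of the nodes that preserves labelled edges and the
formulae at the nodes. -/
structure Emb (Γ Γ' : NestedSeq α At) where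
  toFun : Node Γ → Node Γ'
  edge : ∀ {i b j}, Edge Γ i b j → Edge Γ' (toFun i) b (toFun j)
  holds : ∀ {i B}, Γ.Holds i B → Γ'.Holds (toFun i) B

namespace Emb

variable {Γ Γ' Γ'' : NestedSeq α At}

instance : CoeFun (Emb Γ Γ') fun _ => Node Γ → Node Γ' := ⟨toFun⟩

def refl (Γ : NestedSeq α At) : Emb Γ Γ := ⟨id, id, id⟩

def comp (g : Emb Γ' Γ'') (f : Emb Γ Γ') : Emb Γ Γ'' :=
  ⟨g ∘ f, fun h => g.edge (f.edge h), fun h => g.holds (f.holds h)⟩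

theorem relStr [ConverseAlphabet α] (f : Emb Γ Γ') {x : List α} {i j : Node Γ}
    (h : relStr Γ.Trans x i j) : relStr Γ'.Trans x (f i) (f j) := by
  refine relStr_map f ?_ h
  rintro b s t (h | ⟨c, h, rfl⟩)
  exacts [Or.inl (f.edge h), Or.inr ⟨c, f.edge h, rfl⟩]

end Emb

/-- The node of `Γ[Θ]` that comes from a node of the context. -/
def liftNode : (Γ : NestedSeq α At) → (k : Node Γ) → (Θ : NestedSeq α At) → Node Γ →
    Node (fill Γ k Θ)
  | .nil, .nil, Θ, _ => root Θ
  | .form _ Γ, .form k, Θ, .form i => .form (liftNode Γ k Θ i)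
  | .br _ _ Γ, .outer k, Θ, .outer i => .outer (liftNode Γ k Θ i)
  | .br _ _ _, .outer _, _, .inner i => .inner i
  | .br _ _ _, .inner _, _, .outer i => .outer i
  | .br _ Δ _, .inner k, Θ, .inner i => .inner (liftNode Δ k Θ i)

theorem liftNode_root (Γ : NestedSeq α At) (k : Node Γ) (Θ : NestedSeq α At) :
    liftNode Γ k Θ (root Γ) = root (fill Γ k Θ) := by
  induction Γ with
  | nil => cases k; rfl
  | form A Γ ih =>
    cases k with
    | form k => exact congrArg Node.form (ih k)
  | br a Δ Γ ihΔ ihΓ =>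
    cases k with
    | outer k => exact congrArg Node.outer (ihΓ k)
    | inner k => rfl

/-- A context embeds into each of its fillings. -/
def fillEmb (Γ : NestedSeq α At) (k : Node Γ) (Θ : NestedSeq α At) : Emb Γ (fill Γ k Θ) where
  toFun := liftNode Γ k Θ
  edge {i b j} h := by
    induction Γ with
    | nil => cases i; exact False.elim h
    | form A Γ ih =>
      cases k with | form k => cases i with | form i => cases j with | form j => exact ih k h
    | br a Δ Γ ihΔ ihΓ =>
      rcases k with _ | _ | k | k <;> rcases i with _ | _ | i | i <;>
        rcases j with _ | _ | j | j
      · exact ihΓ k h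
      · obtain ⟨rfl, rfl, rfl⟩ := h
        exact ⟨liftNode_root _ _ _, rfl, rfl⟩
      · exact False.elim h
      · exact h
      · exact h
      · obtain ⟨rfl, rfl, rfl⟩ := h
        exact ⟨rfl, rfl, liftNode_root _ _ _⟩
      · exact False.elim h
      · exact ihΔ k h
  holds {i B} h := by
    induction Γ with
    | nil => cases i; exact False.elim h
    | form A Γ ih =>
      cases k with
      | form k =>
        cases i with
        | form i =>
          rcases h with ⟨rfl, rfl⟩ | h
          · exact Or.inl ⟨liftNode_root _ _ _, rfl⟩
          · exact Or.inr (ih k h)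
    | br a Δ Γ ihΔ ihΓ =>
      rcases k with _ | _ | k | k <;> rcases i with _ | _ | i | i
      exacts [ihΓ k h, h, h, ihΔ k h]

theorem holds_fill_of_holds_root {Γ : NestedSeq α At} {k : Node Γ} {Θ : NestedSeq α At}
    {B : Form α At} (h : Θ.Holds (root Θ) B) : (fill Γ k Θ).Holds (fillEmb Γ k Θ k) B := by
  change (fill Γ k Θ).Holds (liftNode Γ k Θ k) B
  induction Γ with
  | nil => cases k; exact h
  | form A Γ ih => cases k with | form k => exact Or.inr (ih (k := k))
  | br a Δ Γ ihΔ ihΓ =>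
    cases k with
    | outer k => exact ihΓ (k := k)
    | inner k => exact ihΔ (k := k)

theorem exists_child_fill (Γ : NestedSeq α At) (k : Node Γ) (a : α) (A : Form α At) :
    ∃ j, Edge (fill Γ k (bracket a (single A))) (fillEmb Γ k (bracket a (single A)) k) a j ∧
      (fill Γ k (bracket a (single A))).Holds j A := by
  change ∃ j, Edge _ (liftNode Γ k (bracket a (single A)) k) a j ∧ _
  induction Γ with
  | nil =>
    cases k
    exact ⟨.inner (.form .nil), by simp [fill, liftNode, bracket, single, root, Edge],
      Or.inl ⟨rfl, rfl⟩⟩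
  | form B Γ ih =>
    cases k with
    | form k =>
      obtain ⟨j, h1, h2⟩ := ih k
      exact ⟨.form j, h1, Or.inr h2⟩
  | br b Δ Γ ihΔ ihΓ =>
    cases k with
    | outer k =>
      obtain ⟨j, h1, h2⟩ := ihΓ k
      exact ⟨.outer j, h1, h2⟩
    | inner k =>
      obtain ⟨j, h1, h2⟩ := ihΔ k
      exact ⟨.inner j, h1, h2⟩

theorem fill_nil (Γ : NestedSeq α At) (k : Node Γ) : fill Γ k nil = Γ := by
  induction Γ with
  | nil => cases k; rfl
  | form A Γ ih => cases k with | form k => simp only [fill, ih]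
  | br a Δ Γ ihΔ ihΓ => cases k <;> simp only [fill, ihΔ, ihΓ]

theorem Perm.fill (Γ : NestedSeq α At) (k : Node Γ) {Θ Ξ : NestedSeq α At} (h : Perm Θ Ξ) :
    Perm (fill Γ k Θ) (fill Γ k Ξ) := by
  induction Γ with
  | nil => cases k; exact h
  | form A Γ ih => cases k with | form k => exact .form A (ih k)
  | br a Δ Γ ihΔ ihΓ =>
    cases k with
    | outer k => exact .br a (.refl _) (ihΓ k)
    | inner k => exact .br a (ihΔ k) (.refl _)

theorem fill₂_self (Γ : NestedSeq α At) (k : Node Γ) (Θ Ξ : NestedSeq α At) :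
    fill₂ Γ k Θ k Ξ = fill Γ k (Θ ++ Ξ) := by
  induction Γ with
  | nil => cases k; rfl
  | form A Γ ih => cases k with | form k => simp only [fill, fill₂, ih]
  | br a Δ Γ ihΔ ihΓ => cases k <;> simp only [fill, fill₂, ihΔ, ihΓ]

theorem perm_fill_root (A : Form α At) (Γ : NestedSeq α At) :
    Perm (.form A Γ) (fill Γ (root Γ) (single A)) := by
  induction Γ with
  | nil => exact .refl _
  | form B Γ ih => exact (Perm.swapFormForm _ _ _).trans (.form B ih)
  | br a Δ Γ _ ih => exact (Perm.swapFormBr _ _ _ _).trans (.br a (.refl _) ih)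

theorem perm_fill₂_root (A : Form α At) (Γ : NestedSeq α At) (j : Node Γ) (Ξ : NestedSeq α At) :
    Perm (.form A (fill Γ j Ξ)) (fill₂ Γ (root Γ) (single A) j Ξ) := by
  induction Γ with
  | nil => cases j; exact .refl _
  | form B Γ ih =>
    cases j with
    | form j => exact (Perm.swapFormForm _ _ _).trans (.form B (ih j))
  | br a Δ Γ _ ih =>
    cases j with
    | outer j => exact (Perm.swapFormBr _ _ _ _).trans (.br a (.refl _) (ih j))
    | inner j => exact (Perm.swapFormBr _ _ _ _).trans (.br a (.refl _) (perm_fill_root A Γ))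

/-- A formula at the node `i` can be isolated: the rest of the sequent is a context with the same
tree, and a hole anywhere in the sequent becomes a second hole of that context. -/
theorem exists_context_of_holds {Γ : NestedSeq α At} {i : Node Γ} {B : Form α At}
    (h : Γ.Holds i B) :
    ∃ (Γ₀ : NestedSeq α At) (e : Node Γ → Node Γ₀),
      e (root Γ) = root Γ₀ ∧ (∀ k b l, Edge Γ k b l → Edge Γ₀ (e k) b (e l)) ∧
      (∀ k C, Γ.Holds k C → C ≠ B → Γ₀.Holds (e k) C) ∧
      (∀ j Ξ, Perm (fill Γ j Ξ) (fill₂ Γ₀ (e i) (single B) (e j) Ξ)) := by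
  have hfill : ∀ {Γ Γ₀ : NestedSeq α At} {e : Node Γ → Node Γ₀} {i : Node Γ},
      (∀ j Ξ, Perm (fill Γ j Ξ) (fill₂ Γ₀ (e i) (single B) (e j) Ξ)) →
      Perm Γ (fill Γ₀ (e i) (single B)) := by
    intro Γ Γ₀ e i h
    have := h i nil
    rwa [fill_nil, fill₂_self, append_nil] at this
  induction Γ with
  | nil => cases i; exact False.elim h
  | form A Γ ih =>
    cases i with
    | form i =>
      rcases h with ⟨rfl, rfl⟩ | h
      · refine ⟨Γ, fun | .form k => k, rfl, ?_, ?_, ?_⟩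
        · intro k b l h
          cases k; cases l; exact h
        · intro k C h hC
          cases k
          exact h.resolve_left fun h => hC h.2
        · intro j Ξ
          cases j with | form j => exact perm_fill₂_root B Γ j Ξ
      · obtain ⟨Γ₀, e, h1, h2, h4, h3⟩ := ih h
        refine ⟨.form A Γ₀, fun | .form k => .form (e k), congrArg _ h1, ?_, ?_, ?_⟩
        · intro k b l h
          cases k; cases l; exact h2 _ _ _ h
        · intro k C h hC
          cases k
          refine h.imp (fun h => ⟨?_, h.2⟩) fun h => h4 _ _ h hC
          rw [h.1, h1]
        · intro j Ξ
          cases j with | form j => exact .form A (h3 j Ξ)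
  | br a Δ Γ ihΔ ihΓ =>
    cases i with
    | outer i =>
      obtain ⟨Γ₀, e, h1, h2, h4, h3⟩ := ihΓ h
      refine ⟨.br a Δ Γ₀, fun
        | .outer k => .outer (e k)
        | .inner k => .inner k, congrArg _ h1, ?_, ?_, ?_⟩
      · intro k b l h
        cases k <;> cases l
        · exact h2 _ _ _ h
        · obtain ⟨rfl, rfl, rfl⟩ := h
          exact ⟨h1, rfl, rfl⟩
        · exact h
        · exact h
      · intro k C h hC
        cases k
        exacts [h4 _ _ h hC, h]
      · intro j Ξ
        cases j with
        | outer j => exact .br a (.refl _) (h3 j Ξ)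
        | inner j => exact .br a (.refl _) (hfill h3)
    | inner i =>
      obtain ⟨Δ₀, e, h1, h2, h4, h3⟩ := ihΔ h
      refine ⟨.br a Δ₀ Γ, fun
        | .outer k => .outer k
        | .inner k => .inner (e k), rfl, ?_, ?_, ?_⟩
      · intro k b l h
        cases k <;> cases l
        · exact h
        · obtain ⟨rfl, rfl, rfl⟩ := h
          exact ⟨rfl, rfl, h1⟩
        · exact h
        · exact h2 _ _ _ h
      · intro k C h hC
        cases k
        exacts [h, h4 _ _ h hC]
      · intro j Ξ
        cases j with
        | outer j => exact .br a (hfill h3) (.refl _)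
        | inner j => exact .br a (h3 j Ξ) (.refl _)

end NestedSeq

/-! ### The deep calculus in terms of occurrences of formulae -/

namespace DKm

variable {α : Type u} {At : Type v} [ConverseAlphabet α] {S : SemiThue α}
  {Γ : NestedSeq α At} {i j : Node Γ} {a : α} {A B : Form α At} {p : At}

/-- Every rule with a single principal formula can be read in terms of an occurrence of that
formula. -/
theorem exists_fill_of_holds (h : Γ.Holds i A) : ∃ (Γ₀ : NestedSeq α At) (k : Node Γ₀),
    (DKm S (fill Γ₀ k (single A)) → DKm S Γ) ∧
    ∀ Ξ, DKm S (fill Γ i Ξ) → DKm S (fill Γ₀ k (single A ++ Ξ)) := by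
  obtain ⟨Γ₀, e, -, -, -, h3⟩ := exists_context_of_holds h
  refine ⟨Γ₀, e i, fun hd => ?_, fun Ξ hd => ?_⟩
  · have := h3 i .nil
    rw [fill_nil, fill₂_self, append_nil] at this
    exact .exch this.symm hd
  · have := h3 i Ξ
    rw [fill₂_self] at this
    exact .exch this hd

theorem of_holds_prop
    (h : Γ.Holds i (.dia a A)) (hw : ∃ x, relStr Γ.Trans x i j ∧ x ∈ S.lang a)
    (hd : DKm S (fill Γ j (single A))) : DKm S Γ := by
  obtain ⟨Γ₀, e, -, h2, -, h3⟩ := exists_context_of_holds h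
  obtain ⟨x, hx, hxa⟩ := hw
  have hx' : relStr Γ₀.Trans x (e i) (e j) := by
    refine relStr_map e ?_ hx
    rintro b s t (h | ⟨c, h, rfl⟩)
    exacts [Or.inl (h2 _ _ _ h), Or.inr ⟨c, h2 _ _ _ h, rfl⟩]
  have h4 := DKm.prop ⟨x, mem_accepts_propAutomaton.2 hx', hxa⟩ (.exch (h3 j _) hd)
  have := h3 j .nil
  rw [fill_nil] at this
  exact .exch this.symm h4

theorem of_holds_and (h : Γ.Holds i (.and A B)) (hA : DKm S (fill Γ i (single A)))
    (hB : DKm S (fill Γ i (single B))) : DKm S Γ := by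
  obtain ⟨Γ₀, k, h1, h2⟩ := exists_fill_of_holds (S := S) h
  exact h1 (.and (h2 _ hA) (h2 _ hB))

theorem of_holds_or (h : Γ.Holds i (.or A B))
    (hd : DKm S (fill Γ i (single A ++ single B))) : DKm S Γ := by
  obtain ⟨Γ₀, k, h1, h2⟩ := exists_fill_of_holds (S := S) h
  exact h1 (.or (h2 _ hd))

theorem of_holds_box (h : Γ.Holds i (.box a A))
    (hd : DKm S (fill Γ i (bracket a (single A)))) : DKm S Γ := by
  obtain ⟨Γ₀, k, h1, h2⟩ := exists_fill_of_holds (S := S) h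
  exact h1 (.box (h2 _ hd))

theorem of_holds_id (h : Γ.Holds i (.atom p)) (h' : Γ.Holds i (.natom p)) : DKm S Γ := by
  obtain ⟨Γ₀, e, -, -, h0, h3⟩ := exists_context_of_holds h
  obtain ⟨Γ₁, e', -, -, -, h3'⟩ := exists_context_of_holds (h0 _ _ h' (by simp))
  have h1 := h3 i .nil
  rw [fill_nil, fill₂_self, append_nil] at h1
  have h2 := h3' (e i) (single (.atom p))
  rw [fill₂_self] at h2
  exact .exch ((h1.trans h2).trans (.fill _ _ (.append_comm _ _))).symm (.id Γ₁ _ p)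

end DKm

/-! ### Saturation of unprovable nested sequents -/

section Saturation

variable {α : Type u} {At : Type v} [ConverseAlphabet α] {S : SemiThue α}

/-- `Meets S f i B j`: the embedding `f : Γ → Γ'` does what falsifying the formula `B` at the node
`i` of `Γ` requires of `Γ'`. The node `j` only matters for `B = ⟨a⟩A`, where the requirement is
that `A` occur at `j` if `j` can be reached from `i` within `Γ` along a string in `L_a(S)`. -/
def Meets (S : SemiThue α) {Γ Γ' : NestedSeq α At} (f : Emb Γ Γ') (i : Node Γ) (j : Node Γ) :
    Form α At → Prop
  | .atom _ => True
  | .natom _ => True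
  | .or A B => Γ'.Holds (f i) A ∧ Γ'.Holds (f i) B
  | .and A B => Γ'.Holds (f i) A ∨ Γ'.Holds (f i) B
  | .box a A => ∃ k, Edge Γ' (f i) a k ∧ Γ'.Holds k A
  | .dia a A => (∃ x, relStr Γ.Trans x i j ∧ x ∈ S.lang a) → Γ'.Holds (f j) A

theorem Meets.comp {Γ Γ' Γ'' : NestedSeq α At} {f : Emb Γ Γ'} {i j : Node Γ} {B : Form α At}
    (h : Meets S f i j B) (g : Emb Γ' Γ'') : Meets S (g.comp f) i j B := by
  cases B with
  | atom p => trivial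
  | natom p => trivial
  | or A B => exact ⟨g.holds h.1, g.holds h.2⟩
  | and A B => exact h.imp g.holds g.holds
  | box a A =>
    obtain ⟨k, h1, h2⟩ := h
    exact ⟨g k, g.edge h1, g.holds h2⟩
  | dia a A => exact fun hw => g.holds (h hw)

/-- One requirement can be met without losing unprovability: this is a rule of `DKm(S)` read
upwards. -/
theorem exists_emb_meets {Γ Γ' : NestedSeq α At} (hΓ' : ¬ DKm S Γ') (f : Emb Γ Γ') (i j : Node Γ)
    {B : Form α At} (hB : Γ.Holds i B) :
    ∃ (Γ'' : NestedSeq α At) (g : Emb Γ' Γ''), ¬ DKm S Γ'' ∧ Meets S (g.comp f) i j B := by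
  have hB' := f.holds hB
  cases B with
  | atom p => exact ⟨Γ', .refl Γ', hΓ', trivial⟩
  | natom p => exact ⟨Γ', .refl Γ', hΓ', trivial⟩
  | or A B =>
    exact ⟨_, fillEmb Γ' (f i) (single A ++ single B), fun h => hΓ' (.of_holds_or hB' h),
      holds_fill_of_holds_root (Or.inl ⟨rfl, rfl⟩),
      holds_fill_of_holds_root (Or.inr (Or.inl ⟨rfl, rfl⟩))⟩
  | and A B =>
    by_cases hA : DKm S (fill Γ' (f i) (single A))
    · exact ⟨_, fillEmb Γ' (f i) (single B), fun h => hΓ' (.of_holds_and hB' hA h),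
        Or.inr (holds_fill_of_holds_root (Or.inl ⟨rfl, rfl⟩))⟩
    · exact ⟨_, fillEmb Γ' (f i) (single A), hA,
        Or.inl (holds_fill_of_holds_root (Or.inl ⟨rfl, rfl⟩))⟩
  | box a A =>
    exact ⟨_, fillEmb Γ' (f i) (bracket a (single A)), fun h => hΓ' (.of_holds_box hB' h),
      exists_child_fill Γ' (f i) a A⟩
  | dia a A =>
    by_cases hw : ∃ x, relStr Γ.Trans x i j ∧ x ∈ S.lang a
    · obtain ⟨x, hx, hxa⟩ := hw
      exact ⟨_, fillEmb Γ' (f j) (single A),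
        fun h => hΓ' (.of_holds_prop hB' ⟨x, f.relStr hx, hxa⟩ h),
        fun _ => holds_fill_of_holds_root (Or.inl ⟨rfl, rfl⟩)⟩
    · exact ⟨Γ', .refl Γ', hΓ', fun h => absurd h hw⟩

/-- All requirements of an unprovable sequent, of which there are finitely many, can be met at
once. -/
theorem exists_emb_meets_all {Γ : NestedSeq α At} (hΓ : ¬ DKm S Γ) :
    ∃ (Γ' : NestedSeq α At) (f : Emb Γ Γ'), ¬ DKm S Γ' ∧
      ∀ i j B, Γ.Holds i B → Meets S f i j B := by
  have hfin : {q : Node Γ × Node Γ × Form α At | Γ.Holds q.1 q.2.2}.Finite := by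
    refine (Set.finite_iUnion fun p : Node Γ × Node Γ =>
      (Γ.finite_holds p.1).image fun B => (p.1, p.2, B)).subset ?_
    rintro ⟨i, j, B⟩ hB
    exact Set.mem_iUnion.2 ⟨(i, j), B, hB, rfl⟩
  suffices ∀ T : Set (Node Γ × Node Γ × Form α At), T.Finite →
      (∀ q ∈ T, Γ.Holds q.1 q.2.2) → ∃ (Γ' : NestedSeq α At) (f : Emb Γ Γ'), ¬ DKm S Γ' ∧
        ∀ q ∈ T, Meets S f q.1 q.2.1 q.2.2 by
    obtain ⟨Γ', f, h1, h2⟩ := this _ hfin fun _ h => h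
    exact ⟨Γ', f, h1, fun i j B hB => h2 (i, j, B) hB⟩
  intro T hT hTΓ
  induction T, hT using Set.Finite.induction_on with
  | empty => exact ⟨Γ, .refl Γ, hΓ, by simp⟩
  | insert _ _ ih =>
    obtain ⟨Γ', f, h1, h2⟩ := ih fun q hq => hTΓ q (Set.mem_insert_of_mem _ hq)
    obtain ⟨Γ'', g, h3, h4⟩ :=
      exists_emb_meets h1 f _ _ (hTΓ _ (Set.mem_insert _ _))
    refine ⟨Γ'', g.comp f, h3, ?_⟩
    rintro q (rfl | hq)
    exacts [h4, (h2 q hq).comp g]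

end Saturation

/-! ### Derivations in a semi-Thue system -/

section Derives

variable {α : Type u} {S : SemiThue α}

theorem SemiThue.Derives.append {x x' y y' : List α} (h : S.Derives x x') (h' : S.Derives y y') :
    S.Derives (x ++ y) (x' ++ y') := by
  refine Relation.ReflTransGen.trans (b := x' ++ y) ?_ ?_
  · refine Relation.ReflTransGen.lift (· ++ y) ?_ _ _ h
    rintro _ _ ⟨l, r, u, v, huv, rfl, rfl⟩
    exact ⟨l, r ++ y, u, v, huv, by simp, by simp⟩
  · refine Relation.ReflTransGen.lift (x' ++ ·) ?_ _ _ h'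
    rintro _ _ ⟨l, r, u, v, huv, rfl, rfl⟩
    exact ⟨x' ++ l, r, u, v, huv, by simp, by simp⟩

variable [ConverseAlphabet α]

theorem convStr_append (x y : List α) : convStr (x ++ y) = convStr y ++ convStr x := by
  simp [convStr]

theorem SemiThue.Closed.derives_convStr (hcl : S.Closed) {x y : List α} (h : S.Derives x y) :
    S.Derives (convStr x) (convStr y) := by
  induction h with
  | refl => exact .refl
  | tail _ hstep ih =>
    obtain ⟨l, r, x', y', hxy, rfl, rfl⟩ := hstep
    refine ih.tail ⟨convStr r, convStr l, convStr x', convStr y', hcl _ _ hxy, ?_, ?_⟩ <;>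
      simp only [convStr_append, List.append_assoc]

end Derives

/-! ### Completeness of the deep calculus -/

section Limit

variable {α : Type u} {At : Type v} [ConverseAlphabet α] {S : SemiThue α}

/-- An infinite sequence of unprovable sequents, each embedded in the next one, which meets all
its requirements. -/
structure SatChain (S : SemiThue α) (At : Type v) where
  seq : ℕ → NestedSeq α At
  not_derivable : ∀ n, ¬ DKm S (seq n)
  emb : ∀ n, Emb (seq n) (seq (n + 1))
  meets : ∀ n i j B, (seq n).Holds i B → Meets S (emb n) i j B

theorem exists_satChain {Γ : NestedSeq α At} (hΓ : ¬ DKm S Γ) :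
    ∃ C : SatChain S At, C.seq 0 = Γ := by
  choose next f hnext hf using fun Γ : {Γ : NestedSeq α At // ¬ DKm S Γ} =>
    exists_emb_meets_all Γ.2
  let G : ℕ → {Γ : NestedSeq α At // ¬ DKm S Γ} := fun n =>
    n.rec ⟨Γ, hΓ⟩ fun _ Δ => ⟨next Δ, hnext Δ⟩
  exact ⟨⟨fun n => (G n).1, fun n => (G n).2, fun n => f (G n), fun n => hf (G n)⟩, rfl⟩

namespace SatChain

variable (C : SatChain S At)

/-- A thread of the chain represents a node of the limit of its trees: one node in each sequent,
where from some stage on each node is the image of the preceding one. -/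
structure Thread where
  node : ∀ n, Node (C.seq n)
  coherent : ∀ᶠ n in Filter.atTop, node (n + 1) = C.emb n (node n)

/-- Every node of every sequent of the chain lies on a thread. -/
theorem exists_thread (n : ℕ) (i : Node (C.seq n)) :
    ∃ t : C.Thread, t.node n = i ∧ ∀ m, n ≤ m → t.node (m + 1) = C.emb m (t.node m) := by
  classical
  let t : ∀ m, Node (C.seq m) := fun m =>
    if h : n ≤ m then Nat.leRec (motive := fun m _ => Node (C.seq m)) i (fun m _ k => C.emb m k) h
    -- The nodes before stage `n` are irrelevant.
    else root (C.seq m)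
  have ht : ∀ m, n ≤ m → t (m + 1) = C.emb m (t m) := by
    intro m hm
    simp only [t, dif_pos hm, dif_pos (Nat.le_succ_of_le hm)]
    exact Nat.leRec_succ _ _ _
  refine ⟨⟨t, Filter.eventually_atTop.2 ⟨n, ht⟩⟩, ?_, ht⟩
  simp only [t, dif_pos le_rfl]
  exact Nat.leRec_self _ _

variable {C}

/-- A property of pairs of nodes that is inherited along the chain holds eventually as soon as it
holds at a late enough stage. -/
theorem eventually_of_le {P : ∀ n, Node (C.seq n) → Node (C.seq n) → Prop}
    (hP : ∀ n i j, P n i j → P (n + 1) (C.emb n i) (C.emb n j)) {s t : C.Thread} {n : ℕ}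
    (hs : ∀ m, n ≤ m → s.node (m + 1) = C.emb m (s.node m))
    (ht : ∀ m, n ≤ m → t.node (m + 1) = C.emb m (t.node m))
    (h : P n (s.node n) (t.node n)) : ∀ᶠ m in Filter.atTop, P m (s.node m) (t.node m) := by
  refine Filter.eventually_atTop.2 ⟨n, fun m hm => ?_⟩
  induction m, hm using Nat.le_induction with
  | base => exact h
  | succ m hm ih =>
    rw [hs m hm, ht m hm]
    exact hP _ _ _ ih

/-- The formula `B` occurs at the limit node represented by `t`. -/
def Thread.Holds (t : C.Thread) (B : Form α At) : Prop :=
  ∀ᶠ n in Filter.atTop, (C.seq n).Holds (t.node n) B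

theorem Thread.Holds.of_le {t : C.Thread} {B : Form α At} {n : ℕ}
    (ht : ∀ m, n ≤ m → t.node (m + 1) = C.emb m (t.node m))
    (h : (C.seq n).Holds (t.node n) B) : t.Holds B :=
  eventually_of_le (P := fun n i _ => (C.seq n).Holds i B)
    (fun n _ _ h => (C.emb n).holds h) ht ht h

theorem Thread.Holds.exists_stage {t : C.Thread} {B : Form α At} (h : t.Holds B) :
    ∃ n, (C.seq n).Holds (t.node n) B ∧ t.node (n + 1) = C.emb n (t.node n) ∧
      ∀ m, n + 1 ≤ m → t.node (m + 1) = C.emb m (t.node m) := by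
  obtain ⟨n, hn⟩ := Filter.eventually_atTop.1 (h.and t.coherent)
  exact ⟨n, (hn n le_rfl).1, (hn n le_rfl).2, fun m hm => (hn m (Nat.le_of_succ_le hm)).2⟩

/-- There is a walk along `x` from `s` to `t` in the limit of the trees. -/
def Walk (x : List α) (s t : C.Thread) : Prop :=
  ∀ᶠ n in Filter.atTop, relStr (C.seq n).Trans x (s.node n) (t.node n)

theorem Walk.append {x y : List α} {r s t : C.Thread} (h : Walk x r s) (h' : Walk y s t) :
    Walk (x ++ y) r t := by
  filter_upwards [h, h'] with n h h'
  exact relStr_append.2 ⟨_, h, h'⟩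

theorem Walk.convStr {x : List α} {s t : C.Thread} (h : Walk x s t) :
    Walk (convStr x) t s := by
  filter_upwards [h] with n h
  exact relStr_convStr (fun _ _ _ h => h.conv) h

end SatChain

namespace SatChain

variable (C : SatChain S At)

/-- Accessibility in the limit model: there is a walk along some string that the letter `a`
generates. -/
def Rel (a : α) (s t : C.Thread) : Prop :=
  ∃ x ∈ S.lang a, Walk x s t

variable {C}

/-- Walks along strings generated by the letters of `x` concatenate to a walk along a string
generated by `x`. -/
theorem exists_walk_of_relStr {x : List α} {s t : C.Thread} (h : relStr C.Rel x s t) :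
    ∃ y, S.Derives x y ∧ Walk y s t := by
  induction x generalizing s with
  | nil =>
    obtain rfl : s = t := h
    exact ⟨[], .refl, .of_forall fun n => rfl⟩
  | cons a x ih =>
    obtain ⟨r, ⟨y, hy, hw⟩, h2⟩ := h
    obtain ⟨z, hz, hw'⟩ := ih h2
    exact ⟨y ++ z, SemiThue.Derives.append hy hz, hw.append hw'⟩

/-- The model given by the limit of the trees of a chain, in which the formulae at a node are
false. -/
def limitModel (C : SatChain S At) (hcf : S.ContextFree) (hcl : S.Closed) :
    Model.{u, v, max u v} S At where
  W := C.Thread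
  rel := C.Rel
  val p t := ¬ t.Holds (.atom p)
  rel_conv := by
    rintro a s t ⟨x, hx, hw⟩
    exact ⟨convStr x, hcl.derives_convStr hx, hw.convStr⟩
  rel_rule x y hxy s t h := by
    obtain ⟨a, rfl⟩ := hcf x y hxy
    obtain ⟨z, hz, hw⟩ := exists_walk_of_relStr h
    exact relStr_singleton.2
      ⟨z, .head ⟨[], [], [a], y, hxy, rfl, by simp⟩ hz, hw⟩

/-- Truth lemma: the formulae at a node of the limit are false there. -/
theorem not_sat_limitModel (hcf : S.ContextFree) (hcl : S.Closed) {B : Form α At}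
    {t : C.Thread} (h : t.Holds B) : ¬ (C.limitModel hcf hcl).Sat t B := by
  induction B generalizing t with
  | atom p => exact not_not_intro h
  | natom p =>
    refine not_not_intro fun hp => ?_
    obtain ⟨m, h1, h2⟩ := (h.and hp).exists
    exact C.not_derivable m (.of_holds_id h2 h1)
  | or A B hA hB =>
    obtain ⟨n, hn, ht, ht'⟩ := h.exists_stage
    obtain ⟨h1, h2⟩ := C.meets n _ (t.node n) _ hn
    rw [← ht] at h1 h2
    exact not_or.2 ⟨hA (.of_le ht' h1), hB (.of_le ht' h2)⟩
  | and A B hA hB =>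
    obtain ⟨n, hn, ht, ht'⟩ := h.exists_stage
    have h1 := C.meets n _ (t.node n) _ hn
    rcases h1 with h1 | h1 <;> rw [← ht] at h1
    exacts [fun hs => hA (.of_le ht' h1) hs.1, fun hs => hB (.of_le ht' h1) hs.2]
  | box a A hA =>
    obtain ⟨n, hn, ht, ht'⟩ := h.exists_stage
    obtain ⟨k, h1, h2⟩ := C.meets n _ (t.node n) _ hn
    obtain ⟨s, rfl, hs⟩ := C.exists_thread (n + 1) k
    rw [← ht] at h1
    refine fun hsat => hA (.of_le hs h2) (hsat s ⟨[a], .refl, ?_⟩)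
    refine eventually_of_le (P := fun n i j => relStr (C.seq n).Trans [a] i j)
      (fun n _ _ h => (C.emb n).relStr h) ht' hs ?_
    exact relStr_singleton.2 (Or.inl h1)
  | dia a A hA =>
    rintro ⟨s, ⟨x, hx, hw⟩, hsat⟩
    obtain ⟨n, h1⟩ := Filter.eventually_atTop.1 (h.and (hw.and s.coherent))
    obtain ⟨hn, hwn, hs⟩ := h1 n le_rfl
    have h2 := C.meets n _ (s.node n) _ hn ⟨x, hwn, hx⟩
    rw [← hs] at h2
    exact hA (.of_le (fun m hm => (h1 m (Nat.le_of_succ_le hm)).2.2) h2) hsat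

end SatChain

theorem DKm.complete (hcf : S.ContextFree) (hcl : S.Closed) {A : Form α At}
    (h : ∀ (M : Model.{u, v, max u v} S At) (s : M.W), M.Sat s A) : DKm S (single A) := by
  by_contra hA
  obtain ⟨C, hC⟩ := exists_satChain hA
  have hroot : ∃ i, (C.seq 0).Holds i A := by
    rw [hC]
    exact ⟨root (single A), Or.inl ⟨rfl, rfl⟩⟩
  obtain ⟨i, hi⟩ := hroot
  obtain ⟨t, rfl, ht⟩ := C.exists_thread 0 i
  exact SatChain.not_sat_limitModel hcf hcl (.of_le ht hi) (h (C.limitModel hcf hcl) t)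

end Limit

end GrammarLogic

theorem mainTheorem1 {α : Type*} {At : Type*} [GrammarLogic.ConverseAlphabet α]
    (S : GrammarLogic.SemiThue α) (hcf : S.ContextFree) (hcl : S.Closed) :
    ∀ A : GrammarLogic.Form α At,
      GrammarLogic.SKm S (GrammarLogic.NestedSeq.single A) ↔
        GrammarLogic.DKm S (GrammarLogic.NestedSeq.single A) := by
  intro A
  constructor
  · exact fun h => .complete hcf hcl fun M s => M.satSeq_single.1 (h.sound M s)
  · exact fun h => .complete hcf fun M s => M.satSeq_single.1 (h.sound M s)
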